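/- Let $E$ be a real or complex Banach space and let $(e^{tD})_{t\in\mathbb R}$ be a strongly continuous one-parameter group of linear isometries of $E$ with infinitesimal generator $D$, i.e. $Df=\lim_{t\to 0}(e^{tD}f-f)/t$ on the domain of all $f\in E$ for which this limit exists in norm. For $\sigma\ge 0$ let the abstract Bernstein space $\mathbf B_\sigma(D)$ be the set of all $f\in\bigcap_{k}\mathrm{dom}(D^k)$ such that $\|D^kf\|\le\sigma^k\|f\|$ for all $k\in\mathbb N$. For $f\in E$ and $s\ge 0$ let $$\Omega(f,s)=\sup_{|\tau|\le s}\|f-e^{\tau D}f\| .$$ Let $$h(t)=a\left(\frac{\sin(t/4)}{t}\right)^4,\qquad a=\left(\int_{-\infty}^{\infty}\left(\frac{\sin(t/4)}{t}\right)^4dt\right)^{-1},$$ with the value at $t=0$ defined by continuity. Then: 1. The set $\bigcup_{\sigma\ge 0}\mathbf B_\sigma(D)$ is dense in $E$. 2. The function $(\sin(t/4)/t)^4$ is integrable on $\mathbb R$ with positive integral (so that $h$ is well defined with $\int_{-\infty}^{\infty} h=1$), and $h(t)(1+|t|)$ is integrable on $\mathbb R$; put $C_h=\int_{-\infty}^{\infty}h(t)(1+|t|)\,dt<\infty$.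 3. For every $f\in E$, $\Omega(f,s)\to 0$ as $s\to 0^+$. 4. For every $f\in E$ and every $\sigma>0$ the function $t\mapsto h(t)\,e^{(t/\sigma)D}f$ is (Bochner) integrable on $\mathbb R$, the vector $$\mathcal R_h^\sigma(f)=\int_{-\infty}^{\infty}h(t)\,e^{(t/\sigma)D}f\,dt$$ belongs to $\mathbf B_\sigma(D)$, and $$\|f-\mathcal R_h^\sigma(f)\|\le C_h\,\Omega(f,1/\sigma).$$ -/

import Mathlib

open Filter Topology MeasureTheory

/-- A strongly continuous one-parameter group `t ↦ T t = e ^ (t D)` of linear isometries of a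
normed space `E` over `𝕜` (`ℝ` or `ℂ`). -/
structure IsometryGroup (𝕜 E : Type*) [RCLike 𝕜] [NormedAddCommGroup E] [NormedSpace 𝕜 E] where
  toFun : ℝ → (E →ₗᵢ[𝕜] E)
  map_zero' : toFun 0 = LinearIsometry.id
  map_add' : ∀ s t : ℝ, toFun (s + t) = (toFun s).comp (toFun t)
  continuous_orbit' : ∀ f : E, Continuous fun t : ℝ => toFun t f

namespace IsometryGroup

variable {𝕜 E : Type*} [RCLike 𝕜] [NormedAddCommGroup E] [NormedSpace 𝕜 E]

instance : CoeFun (IsometryGroup 𝕜 E) (fun _ => ℝ → (E →ₗᵢ[𝕜] E)) := ⟨toFun⟩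

/-- `T.HasGenerator f g` : the difference quotients `(T t f - f) / t` converge to `g` in norm
as `t → 0`, `t ≠ 0`; that is, `f` is in the domain of the generator `D` and `D f = g`. -/
def HasGenerator (T : IsometryGroup 𝕜 E) (f g : E) : Prop :=
  Tendsto (fun t : ℝ => (t : 𝕜)⁻¹ • (T t f - f)) (𝓝[≠] (0 : ℝ)) (𝓝 g)

theorem HasGenerator.add {T : IsometryGroup 𝕜 E} {f₁ g₁ f₂ g₂ : E}
    (h₁ : T.HasGenerator f₁ g₁) (h₂ : T.HasGenerator f₂ g₂) :
    T.HasGenerator (f₁ + f₂) (g₁ + g₂) := by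
  refine (Tendsto.add h₁ h₂).congr fun t => ?_
  rw [← smul_add, map_add]
  congr 1
  abel

theorem HasGenerator.smul {T : IsometryGroup 𝕜 E} {f g : E} (c : 𝕜)
    (h : T.HasGenerator f g) : T.HasGenerator (c • f) (c • g) := by
  refine (Tendsto.const_smul h c).congr fun t => ?_
  rw [map_smul, ← smul_sub, smul_comm]

theorem HasGenerator.zero (T : IsometryGroup 𝕜 E) : T.HasGenerator 0 0 := by
  simp [HasGenerator]

theorem HasGenerator.unique {T : IsometryGroup 𝕜 E} {f g₁ g₂ : E}
    (h₁ : T.HasGenerator f g₁) (h₂ : T.HasGenerator f g₂) : g₁ = g₂ :=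
  tendsto_nhds_unique h₁ h₂

open Classical in
/-- The infinitesimal generator `D` of the group, a partially defined linear operator: its domain
consists of all `f` for which `lim_{t → 0} (T t f - f) / t` exists, and `D f` is that limit. -/
noncomputable def generator (T : IsometryGroup 𝕜 E) : E →ₗ.[𝕜] E where
  domain :=
    { carrier := {f | ∃ g, T.HasGenerator f g}
      add_mem' := fun ⟨_, h₁⟩ ⟨_, h₂⟩ => ⟨_, h₁.add h₂⟩
      zero_mem' := ⟨_, HasGenerator.zero T⟩
      smul_mem' := fun c _ ⟨_, h⟩ => ⟨_, h.smul c⟩ }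
  toFun :=
    { toFun := fun f => f.2.choose
      map_add' := fun f₁ f₂ =>
        (f₁ + f₂).2.choose_spec.unique (f₁.2.choose_spec.add f₂.2.choose_spec)
      map_smul' := fun c f => (c • f).2.choose_spec.unique (f.2.choose_spec.smul c) }

end IsometryGroup

/-- The composition `B ∘ A` of partially defined operators on its natural domain
`{f ∈ dom A | A f ∈ dom B}`. -/
def LinearPMap.compNatural {𝕜 E : Type*} [Ring 𝕜] [AddCommGroup E] [Module 𝕜 E]
    (B A : E →ₗ.[𝕜] E) : E →ₗ.[𝕜] E where
  domain :=
    { carrier := {f | ∃ hf : f ∈ A.domain, A ⟨f, hf⟩ ∈ B.domain}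
      add_mem' := by
        rintro f₁ f₂ ⟨h₁, k₁⟩ ⟨h₂, k₂⟩
        refine ⟨A.domain.add_mem h₁ h₂, ?_⟩
        have := B.domain.add_mem k₁ k₂
        rwa [← A.map_add] at this
      zero_mem' := by
        refine ⟨A.domain.zero_mem, ?_⟩
        have := B.domain.zero_mem
        rwa [← A.map_zero] at this
      smul_mem' := by
        rintro c f ⟨h, k⟩
        refine ⟨A.domain.smul_mem c h, ?_⟩
        have := B.domain.smul_mem c k
        rwa [← A.map_smul] at this }
  toFun :=
    { toFun := fun f => B ⟨A ⟨f.1, f.2.choose⟩, f.2.choose_spec⟩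
      map_add' := by
        rintro ⟨f₁, h₁, k₁⟩ ⟨f₂, h₂, k₂⟩
        rw [← B.map_add]
        congr 1
        exact Subtype.ext (A.map_add ⟨f₁, h₁⟩ ⟨f₂, h₂⟩)
      map_smul' := by
        rintro c ⟨f, h, k⟩
        rw [RingHom.id_apply, ← B.map_smul]
        congr 1
        exact Subtype.ext (A.map_smul c ⟨f, h⟩) }

/-- The powers `A ^ k` of a partially defined operator: `A ^ 0 = I` on the whole space, and
`A ^ (k + 1) = A ∘ A ^ k` on its natural domain. -/
def LinearPMap.power {𝕜 E : Type*} [Ring 𝕜] [AddCommGroup E] [Module 𝕜 E]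
    (A : E →ₗ.[𝕜] E) : ℕ → (E →ₗ.[𝕜] E)
  | 0 => (LinearMap.id : E →ₗ[𝕜] E).toPMap ⊤
  | k + 1 => A.compNatural (A.power k)

/-- The abstract Bernstein space `B_σ(D)`: all `f` that lie in the domain of every power `D ^ k`
and satisfy `‖D ^ k f‖ ≤ σ ^ k ‖f‖` for all `k`. -/
def bernsteinSpace {𝕜 E : Type*} [RCLike 𝕜] [NormedAddCommGroup E] [NormedSpace 𝕜 E]
    (D : E →ₗ.[𝕜] E) (σ : ℝ) : Set E :=
  {f | ∀ k : ℕ, ∃ hf : f ∈ (D.power k).domain, ‖D.power k ⟨f, hf⟩‖ ≤ σ ^ k * ‖f‖}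

/-- The modulus of continuity `Ω(f, s) = sup_{|τ| ≤ s} ‖f - T τ f‖`. The set is bounded by
`2 ‖f‖`, and it is nonempty for `s ≥ 0`. -/
noncomputable def IsometryGroup.modulus {𝕜 E : Type*} [RCLike 𝕜] [NormedAddCommGroup E]
    [NormedSpace 𝕜 E] (T : IsometryGroup 𝕜 E) (f : E) (s : ℝ) : ℝ :=
  sSup ((fun τ : ℝ => ‖f - T τ f‖) '' {τ : ℝ | |τ| ≤ s})

/-- The function `(sin (t / 4) / t) ^ 4`, extended continuously by `(1 / 4) ^ 4` at `t = 0`. -/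
noncomputable def sinKernel (t : ℝ) : ℝ :=
  (if t = 0 then 1 / 4 else Real.sin (t / 4) / t) ^ 4

/-- The normalized kernel `h(t) = a (sin (t / 4) / t) ^ 4`, where `a` is the reciprocal of the
integral of `(sin (t / 4) / t) ^ 4` over the line. -/
noncomputable def normKernel (t : ℝ) : ℝ :=
  (∫ s : ℝ, sinKernel s)⁻¹ * sinKernel t

/-- The average `∫ h(t) T(t / σ) f dt` of the orbit of `f` against the kernel `h`. -/
noncomputable def IsometryGroup.average {𝕜 E : Type*} [RCLike 𝕜] [NormedAddCommGroup E]
    [NormedSpace 𝕜 E] [NormedSpace ℝ E] (T : IsometryGroup 𝕜 E) (σ : ℝ) (f : E) : E :=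
  ∫ t : ℝ, normKernel t • T (t / σ) f

/-! The kernel is band-limited: `sinKernel` is the Fourier transform of a positive measure on `[-1,
1]`. For each such frequency the triangle wave gives `w = ∑ c_k · 2 sin (x_k w)`, with `x_k =
rieszNode k` and `c_k = rieszCoeff k`. Integrating this against the measure yields M. Riesz's
formula `h' t = ∑ c_k (h (t + x_k) - h (t - x_k))`, where `∑ |c_k| = 1/2`.

Let `g = T.average σ f`. Translating `g` along the group shifts `h` under the integral, so `g` is in
the domain of `D` and `D g = -σ ∫ h' t • T (t / σ) f`. By Riesz's formula `D g = R g`, where `R =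
rieszOperator σ` has norm at most `2 σ ∑ |c_k| = σ`. Since `R` commutes with the group, `D ^ k g = R
^ k g`, which is the Bernstein estimate with the exact constant `σ ^ k`.

For the approximation, split `t / σ` into at most `1 + |t|` equal steps of length at most `1 / σ`.
As the group is isometric, `‖f - T (t / σ) f‖ ≤ (1 + |t|) Ω(f, 1 / σ)`; integrate this against `h`,
whose integral is `1`. Density follows by letting `σ → ∞`. -/

/-! ### Riesz nodes and coefficients: the triangle wave as a sine series. -/

section RieszInterpolation

open Real

/-- The nodes `(2 k + 1) π / 2` of the Riesz interpolation formula. -/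
noncomputable def rieszNode (k : ℕ) : ℝ := (2 * k + 1) * π / 2

/-- The coefficients of the Riesz interpolation formula. -/
noncomputable def rieszCoeff (k : ℕ) : ℝ := 4 / π ^ 2 * ((-1) ^ k / (2 * k + 1) ^ 2)

/-- Fourier series of the Bernoulli polynomial `B₂`. -/
theorem hasSum_cos_div_sq {x : ℝ} (hx : x ∈ Set.Icc (0 : ℝ) 1) :
    HasSum (fun n : ℕ => 1 / (n : ℝ) ^ 2 * cos (2 * π * n * x)) (π ^ 2 * (x ^ 2 - x + 6⁻¹)) := by
  have h := hasSum_one_div_nat_pow_mul_cos one_ne_zero hx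
  have hB : (Polynomial.map (algebraMap ℚ ℝ) (Polynomial.bernoulli 2)).eval x = x ^ 2 - x + 6⁻¹ :=
    bernoulliFun_two x
  simp only [mul_one, hB] at h
  convert! h using 1
  simp only [Nat.factorial]
  push_cast
  ring

/-- The even-indexed terms of the `B₂` series at `x` are a quarter of the series at `2 * x`, and
subtracting them leaves the odd ones. The point `2 * x` must stay in `[0, 1]`, hence the bound `1 /
2`. -/
theorem hasSum_cos_odd_div_sq {x : ℝ} (hx : x ∈ Set.Icc (0 : ℝ) (1 / 2)) :
    HasSum (fun k : ℕ => 1 / (2 * k + 1 : ℝ) ^ 2 * cos (2 * π * (2 * k + 1) * x))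
      (π ^ 2 * (1 / 8 - x / 2)) := by
  set f : ℝ → ℕ → ℝ := fun x n => 1 / (n : ℝ) ^ 2 * cos (2 * π * n * x) with hf
  have h₁ : HasSum (f x) _ := hasSum_cos_div_sq (x := x) ⟨hx.1, by linarith [hx.2]⟩
  have h₂ : HasSum (f (2 * x)) _ :=
    hasSum_cos_div_sq (x := 2 * x) ⟨by linarith [hx.1], by linarith [hx.2]⟩
  have hinj : Function.Injective fun k : ℕ => 2 * k + 1 := fun a b h => by
    simpa using h
  have hodd : HasSum (fun k => f x (2 * k + 1)) (∑' k, f x (2 * k + 1)) :=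
    (h₁.summable.comp_injective hinj).hasSum
  have hmul : ∀ k, f x (2 * k) = 1 / 4 * f (2 * x) k := fun k => by
    have h4 : (1 : ℝ) / (2 * k) ^ 2 = 1 / 4 * (1 / (k : ℝ) ^ 2) := by
      rw [mul_pow, one_div_mul_one_div]
      norm_num
    simp only [hf]
    push_cast
    rw [h4, show 2 * π * (2 * (k : ℝ)) * x = 2 * π * k * (2 * x) by ring, mul_assoc]
  have heven : HasSum (fun k => f x (2 * k)) _ := (h₂.mul_left (1 / 4)).congr_fun hmul
  have huniq := (HasSum.even_add_odd heven hodd).unique h₁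
  have hval : ∑' k, f x (2 * k + 1) = π ^ 2 * (1 / 8 - x / 2) := by linarith
  rw [hval] at hodd
  refine hodd.congr_fun fun k => ?_
  simp only [hf]
  push_cast
  rfl

theorem sin_rieszNode_mul (k : ℕ) (w : ℝ) :
    cos (2 * π * (2 * k + 1) * ((1 - w) / 4)) = (-1) ^ k * sin (rieszNode k * w) := by
  rw [show 2 * π * (2 * (k : ℝ) + 1) * ((1 - w) / 4)
    = (π / 2 - rieszNode k * w) + k * π by unfold rieszNode; ring, cos_add_nat_mul_pi,
    cos_pi_div_two_sub]

theorem rieszCoeff_mul (k : ℕ) : rieszCoeff k * (-1) ^ k = 4 / π ^ 2 * (1 / (2 * k + 1) ^ 2) := by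
  rw [rieszCoeff, mul_assoc, div_mul_eq_mul_div ((-1 : ℝ) ^ k), ← mul_pow]
  norm_num

/-- The Fourier expansion of the triangle wave. -/
theorem hasSum_rieszCoeff_mul_sin {w : ℝ} (hw : |w| ≤ 1) :
    HasSum (fun k : ℕ => rieszCoeff k * (2 * sin (rieszNode k * w))) w := by
  obtain ⟨h₁, h₂⟩ := abs_le.1 hw
  have h := (hasSum_cos_odd_div_sq (x := (1 - w) / 4)
    ⟨by linarith, by linarith⟩).mul_left (8 / π ^ 2)
  convert! h using 1
  · ext k
    rw [sin_rieszNode_mul]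
    have : ((-1 : ℝ) ^ k) * (-1) ^ k = 1 := by rw [← mul_pow]; norm_num
    simp only [rieszCoeff]
    ring
  · field_simp
    ring

theorem abs_rieszCoeff (k : ℕ) : |rieszCoeff k| = rieszCoeff k * (-1) ^ k := by
  rw [rieszCoeff_mul, rieszCoeff, abs_mul,
    abs_of_nonneg (by positivity : (0 : ℝ) ≤ 4 / π ^ 2), abs_div, abs_pow, abs_neg, abs_one,
    one_pow, abs_of_nonneg (by positivity : (0 : ℝ) ≤ (2 * k + 1) ^ 2)]

/-- The odd series at `x = 0` is `∑ 1 / (2 k + 1) ^ 2 = π ^ 2 / 8`. The exact value `1 / 2` is what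
makes the Bernstein constant exactly `σ`. -/
theorem hasSum_abs_rieszCoeff : HasSum (fun k => |rieszCoeff k|) (1 / 2) := by
  have h := (hasSum_cos_odd_div_sq (x := 0) ⟨le_rfl, by norm_num⟩).mul_left (4 / π ^ 2)
  convert! h using 1
  · ext k
    rw [abs_rieszCoeff, rieszCoeff_mul]
    simp
  · field_simp
    ring

end RieszInterpolation

/-! ### Fourier transforms of measures with bounded support. -/

section BandLimited

open Complex

variable {ν : Measure ℝ} [IsFiniteMeasure ν]

theorem norm_cexp_mul_mul_I (t w : ℝ) : ‖cexp (t * w * I)‖ = 1 := by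
  rw [← ofReal_mul, norm_exp_ofReal_mul_I]

theorem hasDerivAt_charFun_of_bounded {r : ℝ} (hν : ∀ᵐ w ∂ν, |w| ≤ r) (t : ℝ) :
    HasDerivAt (charFun ν) (∫ w, w * I * cexp (t * w * I) ∂ν) t := by
  have key := hasDerivAt_integral_of_dominated_loc_of_deriv_le (μ := ν) (x₀ := t)
    (F := fun (s : ℝ) (w : ℝ) => cexp (s * w * I))
    (F' := fun (s : ℝ) (w : ℝ) => w * I * cexp (s * w * I))
    (bound := fun _ => r) (s := Set.univ) univ_mem
    (.of_forall fun s => by fun_prop)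
    (.of_bound (by fun_prop) 1 (.of_forall fun w => (norm_cexp_mul_mul_I _ _).le))
    (by fun_prop)
    (hν.mono fun w hw s _ => by
      rw [norm_mul, norm_cexp_mul_mul_I, norm_mul, norm_I, norm_real]
      simpa using hw)
    (integrable_const r)
    (.of_forall fun w s _ => by
      have h := ((hasDerivAt_id s).ofReal_comp.mul_const (w : ℂ)).mul_const I |>.cexp
      convert! h using 1
      rw [ofReal_one, id]
      ring)
  refine key.2.congr_of_eventuallyEq (.of_forall fun s => ?_)
  exact charFun_apply_real s

theorem norm_integral_mul_cexp_le {r : ℝ} (hν : ∀ᵐ w ∂ν, |w| ≤ r) (t : ℝ) :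
    ‖∫ w, w * I * cexp (t * w * I) ∂ν‖ ≤ r * ν.real Set.univ :=
  norm_integral_le_of_norm_le_const (hν.mono fun w hw => by
    rw [norm_mul, norm_cexp_mul_mul_I, norm_mul, norm_I, norm_real]
    simpa using hw)

theorem cexp_sub_cexp (t a w : ℝ) :
    cexp ((t + a : ℝ) * w * I) - cexp ((t - a : ℝ) * w * I)
      = 2 * Real.sin (a * w) * I * cexp (t * w * I) := by
  have h₁ : ((t + a : ℝ) : ℂ) * w * I = t * w * I + (a * w : ℝ) * I := by push_cast; ring
  have h₂ : ((t - a : ℝ) : ℂ) * w * I = t * w * I + (-(a * w : ℝ) : ℂ) * I := by push_cast; ring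
  rw [h₁, h₂, Complex.exp_add, Complex.exp_add, Complex.exp_mul_I ((a * w : ℝ) : ℂ),
    Complex.exp_mul_I (-_), Complex.cos_neg, Complex.sin_neg, ofReal_sin]
  ring

/-- The Riesz interpolation formula for the characteristic function of a measure concentrated on
`[-1, 1]`. -/
theorem hasSum_rieszCoeff_mul_charFun (hν : ∀ᵐ w ∂ν, |w| ≤ 1) (t : ℝ) :
    HasSum (fun k => (rieszCoeff k : ℂ)
        * (charFun ν (t + rieszNode k) - charFun ν (t - rieszNode k)))
      (∫ w, w * I * cexp (t * w * I) ∂ν) := by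
  have hint : ∀ s : ℝ, Integrable (fun w : ℝ => cexp (s * w * I)) ν := fun s =>
    .of_bound (by fun_prop) 1 (.of_forall fun w => (norm_cexp_mul_mul_I _ _).le)
  set F : ℕ → ℝ → ℂ := fun k w => (rieszCoeff k : ℂ) *
    (cexp ((t + rieszNode k : ℝ) * w * I) - cexp ((t - rieszNode k : ℝ) * w * I)) with hF
  have hFi : ∀ k, Integrable (F k) ν := fun k => ((hint _).sub (hint _)).const_mul _
  have hFn : ∀ k, ∫ w, ‖F k w‖ ∂ν ≤ |rieszCoeff k| * (2 * ν.real Set.univ) := fun k => by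
    refine (integral_mono (hFi k).norm (integrable_const (|rieszCoeff k| * 2)) fun w => ?_).trans
      (le_of_eq ?_)
    · simp only [hF, norm_mul, norm_real, Real.norm_eq_abs]
      refine mul_le_mul_of_nonneg_left ((norm_sub_le _ _).trans ?_) (abs_nonneg _)
      rw [norm_cexp_mul_mul_I, norm_cexp_mul_mul_I]
      norm_num
    · rw [integral_const, smul_eq_mul]
      ring
  have key := hasSum_integral_of_summable_integral_norm hFi
    (.of_nonneg_of_le (fun k => integral_nonneg fun _ => norm_nonneg _) hFn
      (hasSum_abs_rieszCoeff.summable.mul_right _))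
  convert! key using 1
  · ext k
    rw [integral_const_mul, integral_sub (hint _) (hint _), charFun_apply_real, charFun_apply_real]
  -- The triangle-wave identity holds only for `|w| ≤ 1`, which is almost every `w`.
  · refine integral_congr_ae (hν.mono fun w hw => ?_)
    have h := (((hasSum_rieszCoeff_mul_sin hw).mapL ofRealCLM).mul_right I).mul_right
      (cexp (t * w * I))
    refine (Eq.symm ?_)
    refine (HasSum.tsum_eq ?_)
    convert! h using 2 with k
    simp only [hF, cexp_sub_cexp, ofRealCLM_apply]
    push_cast
    ring

theorem ae_conv_abs_le {μ ν : Measure ℝ} [SFinite μ] [SFinite ν] {a b : ℝ}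
    (hμ : ∀ᵐ w ∂μ, |w| ≤ a) (hν : ∀ᵐ w ∂ν, |w| ≤ b) : ∀ᵐ w ∂(μ.conv ν), |w| ≤ a + b := by
  rw [Measure.conv, ae_map_iff (by fun_prop) (measurableSet_le (by fun_prop) (by fun_prop))]
  filter_upwards [Measure.quasiMeasurePreserving_fst.ae hμ,
    Measure.quasiMeasurePreserving_snd.ae hν] with x hx hy
  exact (abs_add_le _ _).trans (add_le_add hx hy)

end BandLimited

/-! ### Decay, band-limitation and derivative of the unnormalized kernel. -/

section SincKernel

open Real

theorem sinKernel_eq_sinc (t : ℝ) : sinKernel t = (sinc (t / 4) / 4) ^ 4 := by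
  rw [sinKernel]
  congr 1
  split_ifs with h
  · simp [h]
  · rw [sinc_of_ne_zero (by positivity)]
    field_simp

theorem continuous_sinKernel : Continuous sinKernel := by
  rw [funext sinKernel_eq_sinc]
  fun_prop

theorem sinKernel_nonneg (t : ℝ) : 0 ≤ sinKernel t := by
  rw [sinKernel]
  exact Even.pow_nonneg (by decide) _

theorem sinc_sq_le (t : ℝ) : (sinc (t / 4) / 4) ^ 2 ≤ 1 / 16 := by
  have h := sq_le_one_iff_abs_le_one _ |>.2 (abs_sinc_le_one (t / 4))
  rw [div_pow]
  linarith

theorem sinc_sq_mul_one_add_sq_le (t : ℝ) : (sinc (t / 4) / 4) ^ 2 * (1 + t ^ 2) ≤ 2 := by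
  have h₁ := sinc_sq_le t
  have h₂ : (sinc (t / 4) / 4) ^ 2 * t ^ 2 ≤ 1 := by
    rw [← mul_pow]
    rcases eq_or_ne t 0 with rfl | ht
    · simp
    · rw [sinc_of_ne_zero (by positivity), show sin (t / 4) / (t / 4) / 4 * t = sin (t / 4) by
        field_simp]
      exact sin_sq_le_one _
  linarith

theorem sinc_sq_le_inv (t : ℝ) : (sinc (t / 4) / 4) ^ 2 ≤ 2 * (1 + t ^ 2)⁻¹ := by
  rw [← div_eq_mul_inv, le_div_iff₀ (by positivity)]
  exact sinc_sq_mul_one_add_sq_le t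

/-- The fourth power is a product of two squares: one supplies the integrable decay, the other
absorbs `1 + |t|`. -/
theorem sinKernel_mul_le (t : ℝ) : sinKernel t * (1 + |t|) ≤ 6 * (1 + t ^ 2)⁻¹ := by
  have h₁ := sinc_sq_mul_one_add_sq_le t
  have h₂ : (sinc (t / 4) / 4) ^ 2 * (1 + |t|) ≤ 3 := by
    have h₃ : 1 + |t| ≤ 2 + t ^ 2 := by nlinarith [sq_abs t, sq_nonneg (|t| - 1)]
    have h₄ := mul_le_mul_of_nonneg_left h₃ (sq_nonneg (sinc (t / 4) / 4))
    linarith [sinc_sq_le t]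
  calc sinKernel t * (1 + |t|)
      = (sinc (t / 4) / 4) ^ 2 * ((sinc (t / 4) / 4) ^ 2 * (1 + |t|)) := by
        rw [sinKernel_eq_sinc]; ring
    _ ≤ (2 * (1 + t ^ 2)⁻¹) * 3 :=
        mul_le_mul (sinc_sq_le_inv t) h₂ (by positivity) (by positivity)
    _ = 6 * (1 + t ^ 2)⁻¹ := by ring

theorem integrable_sinKernel_mul : Integrable fun t : ℝ => sinKernel t * (1 + |t|) := by
  refine (integrable_inv_one_add_sq.const_mul 6).mono'
    (continuous_sinKernel.mul (by fun_prop)).aestronglyMeasurable (.of_forall fun t => ?_)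
  rw [norm_of_nonneg (mul_nonneg (sinKernel_nonneg t) (by positivity))]
  exact sinKernel_mul_le t

theorem integrable_sinKernel : Integrable sinKernel := by
  refine integrable_sinKernel_mul.mono' continuous_sinKernel.aestronglyMeasurable
    (.of_forall fun t => ?_)
  rw [norm_of_nonneg (sinKernel_nonneg t)]
  exact le_mul_of_one_le_right (sinKernel_nonneg t) (by linarith [abs_nonneg t])

theorem integral_sinKernel_pos : 0 < ∫ t : ℝ, sinKernel t := by
  rw [integral_pos_iff_support_of_nonneg sinKernel_nonneg integrable_sinKernel]
  exact continuous_sinKernel.isOpen_support.measure_pos _ ⟨0, by simp [sinKernel]⟩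

/-- The uniform measure of mass `1 / 4` on `[-1 / 4, 1 / 4]`. -/
noncomputable def quarterMeasure : Measure ℝ :=
  (2⁻¹ : ENNReal) • volume.restrict (Set.Ioc (-(1 / 4)) (1 / 4))

instance : IsFiniteMeasure quarterMeasure :=
  ⟨by simp [quarterMeasure, ENNReal.mul_lt_top_iff]⟩

theorem charFun_quarterMeasure (t : ℝ) : charFun quarterMeasure t = (sinc (t / 4) / 4 : ℝ) := by
  rw [charFun_apply_real, quarterMeasure, integral_smul_measure,
    ← intervalIntegral.integral_of_le (by norm_num)]
  rcases eq_or_ne t 0 with rfl | ht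
  · norm_num
  have h := intervalIntegral.integral_comp_mul_left (a := -(1 / 4)) (b := 1 / 4)
    (fun x : ℝ => Complex.exp (x * Complex.I)) ht
  rw [show t * -(1 / 4) = -(t / 4) by ring, show t * (1 / 4) = t / 4 by ring,
    integral_exp_mul_I_eq_sinc] at h
  push_cast at h
  rw [h]
  have : (t : ℂ) ≠ 0 := by exact_mod_cast ht
  simp [Complex.real_smul]
  field_simp

theorem ae_quarterMeasure : ∀ᵐ w ∂quarterMeasure, |w| ≤ 1 / 4 := by
  refine Measure.ae_smul_measure ?_ _
  filter_upwards [ae_restrict_mem measurableSet_Ioc] with w hw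
  exact abs_le.2 ⟨hw.1.le, hw.2⟩

/-- The positive measure on `[-1, 1]` whose characteristic function is `sinKernel`. -/
noncomputable def sinMeasure : Measure ℝ :=
  (quarterMeasure.conv quarterMeasure).conv (quarterMeasure.conv quarterMeasure)

instance : IsFiniteMeasure sinMeasure := by
  unfold sinMeasure
  infer_instance

theorem charFun_sinMeasure (t : ℝ) : charFun sinMeasure t = sinKernel t := by
  rw [sinMeasure, charFun_conv, charFun_conv, charFun_quarterMeasure, sinKernel_eq_sinc]
  push_cast
  ring

theorem ae_sinMeasure : ∀ᵐ w ∂sinMeasure, |w| ≤ 1 := by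
  have h := ae_conv_abs_le ae_quarterMeasure ae_quarterMeasure
  refine (ae_conv_abs_le h h).mono fun w hw => hw.trans (by norm_num)

theorem hasDerivAt_re_charFun {ν : Measure ℝ} [IsFiniteMeasure ν] {F : ℝ → ℝ} {r : ℝ}
    (hν : ∀ᵐ w ∂ν, |w| ≤ r) (hF : ∀ t, charFun ν t = F t) (t : ℝ) :
    HasDerivAt F (∫ w, w * Complex.I * Complex.exp (t * w * Complex.I) ∂ν).re t := by
  have h := Complex.reCLM.hasFDerivAt.comp_hasDerivAt t (hasDerivAt_charFun_of_bounded hν t)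
  refine h.congr_of_eventuallyEq (.of_forall fun s => ?_)
  simp [hF]

theorem differentiable_sinKernel : Differentiable ℝ sinKernel := fun t =>
  (hasDerivAt_re_charFun ae_sinMeasure charFun_sinMeasure t).differentiableAt

theorem hasSum_deriv_sinKernel (t : ℝ) :
    HasSum (fun k => rieszCoeff k * (sinKernel (t + rieszNode k) - sinKernel (t - rieszNode k)))
      (deriv sinKernel t) := by
  rw [(hasDerivAt_re_charFun ae_sinMeasure charFun_sinMeasure t).deriv]
  have h := Complex.hasSum_re (hasSum_rieszCoeff_mul_charFun ae_sinMeasure t)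
  refine h.congr_fun fun k => ?_
  rw [charFun_sinMeasure, charFun_sinMeasure, ← Complex.ofReal_sub, ← Complex.ofReal_mul,
    Complex.ofReal_re]

/-- By the chain rule the derivative is `4 q ^ 3 q'` with `q t = sinc (t / 4) / 4`. Band-limitation
bounds `q'`, and `q ^ 3` keeps the decay of `q ^ 2`. -/
theorem abs_deriv_sinKernel_le (t : ℝ) : |deriv sinKernel t| ≤ 2 * (1 + t ^ 2)⁻¹ := by
  have h := hasDerivAt_re_charFun ae_quarterMeasure charFun_quarterMeasure t
  have hb := (Complex.abs_re_le_norm _).trans (norm_integral_mul_cexp_le ae_quarterMeasure t)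
  have hm : quarterMeasure.real Set.univ = 1 / 4 := by
    simp [quarterMeasure, Measure.real]
    norm_num
  rw [hm] at hb
  have hd := h.pow 4
  rw [show (fun t : ℝ => sinc (t / 4) / 4) ^ 4 = sinKernel from
    funext fun s => (sinKernel_eq_sinc s).symm] at hd
  rw [hd.deriv, abs_mul, abs_mul]
  have h₁ := sinc_sq_le_inv t
  have h₂ : |sinc (t / 4) / 4| ≤ 1 := by
    rw [abs_div]
    have := abs_sinc_le_one (t / 4)
    norm_num
    linarith
  have h₃ : |(sinc (t / 4) / 4) ^ (4 - 1)| ≤ 2 * (1 + t ^ 2)⁻¹ := by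
    rw [show 4 - 1 = 2 + 1 from rfl, pow_succ, abs_mul, abs_of_nonneg (sq_nonneg _)]
    exact (mul_le_of_le_one_right (sq_nonneg _) h₂).trans h₁
  have h₄ : |((4 : ℕ) : ℝ)| = 4 := by norm_num
  rw [h₄]
  have h₅ : (0 : ℝ) ≤ 2 * (1 + t ^ 2)⁻¹ := by positivity
  have := mul_le_mul h₃ hb (abs_nonneg _) h₅
  nlinarith

theorem inv_one_add_sub_sq_le (t : ℝ) {u : ℝ} (hu : |u| ≤ 1) :
    (1 + (t - u) ^ 2)⁻¹ ≤ 3 * (1 + t ^ 2)⁻¹ := by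
  rw [← div_eq_mul_inv, inv_eq_one_div, div_le_div_iff₀ (by positivity) (by positivity)]
  have : u ^ 2 ≤ 1 := (sq_le_one_iff_abs_le_one u).2 hu
  nlinarith [sq_nonneg (t - 2 * u)]

end SincKernel

/-! ### Transfer to the normalized kernel. -/

section NormKernel

theorem continuous_normKernel : Continuous normKernel :=
  continuous_const.mul continuous_sinKernel

theorem normKernel_nonneg (t : ℝ) : 0 ≤ normKernel t :=
  mul_nonneg (inv_nonneg.2 integral_sinKernel_pos.le) (sinKernel_nonneg t)

theorem integrable_normKernel : Integrable normKernel := integrable_sinKernel.const_mul _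

theorem integral_normKernel : ∫ t, normKernel t = 1 := by
  simp only [normKernel]
  rw [integral_const_mul, inv_mul_cancel₀ integral_sinKernel_pos.ne']

theorem integrable_normKernel_mul : Integrable fun t : ℝ => normKernel t * (1 + |t|) := by
  simp only [normKernel, mul_assoc]
  exact integrable_sinKernel_mul.const_mul _

theorem hasDerivAt_normKernel (t : ℝ) : HasDerivAt normKernel (deriv normKernel t) t :=
  ((differentiable_sinKernel t).const_mul _).hasDerivAt

theorem deriv_normKernel (t : ℝ) :
    deriv normKernel t = (∫ s : ℝ, sinKernel s)⁻¹ * deriv sinKernel t :=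
  ((differentiable_sinKernel t).hasDerivAt.const_mul _).deriv

theorem hasSum_deriv_normKernel (t : ℝ) :
    HasSum (fun k => rieszCoeff k * (normKernel (t + rieszNode k) - normKernel (t - rieszNode k)))
      (deriv normKernel t) := by
  rw [deriv_normKernel]
  refine ((hasSum_deriv_sinKernel t).mul_left _).congr_fun fun k => ?_
  simp only [normKernel]
  ring

/-- Domination uniform over small shifts, as needed to differentiate under the integral sign. -/
theorem exists_abs_deriv_normKernel_le :
    ∃ C, ∀ t u : ℝ, |u| ≤ 1 → |deriv normKernel (t - u)| ≤ C * (1 + t ^ 2)⁻¹ := by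
  refine ⟨(∫ s : ℝ, sinKernel s)⁻¹ * 6, fun t u hu => ?_⟩
  have hI := inv_pos.2 integral_sinKernel_pos
  rw [deriv_normKernel, abs_mul, abs_of_pos hI, mul_assoc]
  refine mul_le_mul_of_nonneg_left ?_ hI.le
  have h₁ := abs_deriv_sinKernel_le (t - u)
  have h₂ := inv_one_add_sub_sq_le t hu
  linarith

end NormKernel

/-! ### Isometry groups: powers of the generator, modulus of continuity, orbit integrals. -/

namespace IsometryGroup

section Basic

variable {𝕜 E : Type*} [RCLike 𝕜] [NormedAddCommGroup E] [NormedSpace 𝕜 E]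
  (T : IsometryGroup 𝕜 E)

theorem map_zero_apply (f : E) : T 0 f = f := by
  rw [T.map_zero']
  rfl

theorem map_add_apply (s t : ℝ) (f : E) : T (s + t) f = T s (T t f) := by
  rw [T.map_add']
  rfl

theorem map_comm (s t : ℝ) (f : E) : T s (T t f) = T t (T s f) := by
  rw [← map_add_apply, add_comm, map_add_apply]

theorem continuous_orbit (f : E) : Continuous fun t : ℝ => T t f := T.continuous_orbit' f

variable {T} in
theorem HasGenerator.exists_generator_eq {f g : E} (h : T.HasGenerator f g) :
    ∃ hf : f ∈ T.generator.domain, T.generator ⟨f, hf⟩ = g :=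
  ⟨⟨g, h⟩, HasGenerator.unique (Exists.choose_spec (⟨g, h⟩ : ∃ g, T.HasGenerator f g)) h⟩

theorem exists_power_generator_eq {u : ℕ → E} (hu : ∀ k, T.HasGenerator (u k) (u (k + 1)))
    (k : ℕ) : ∃ hf : u 0 ∈ (T.generator.power k).domain, T.generator.power k ⟨u 0, hf⟩ = u k := by
  induction k with
  | zero => exact ⟨Submodule.mem_top, rfl⟩
  | succ k ih =>
    obtain ⟨h₁, h₂⟩ := ih
    obtain ⟨h₃, h₄⟩ := (hu k).exists_generator_eq
    have h₅ : T.generator.power k ⟨u 0, h₁⟩ ∈ T.generator.domain := h₂ ▸ h₃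
    refine ⟨⟨h₁, h₅⟩, ?_⟩
    rw [← h₄]
    exact congrArg T.generator (Subtype.ext h₂)

theorem bddAbove_modulus (f : E) (s : ℝ) :
    BddAbove ((fun τ : ℝ => ‖f - T τ f‖) '' {τ : ℝ | |τ| ≤ s}) := by
  refine ⟨‖f‖ + ‖f‖, ?_⟩
  rintro _ ⟨τ, -, rfl⟩
  exact (norm_sub_le _ _).trans_eq (by rw [(T τ).norm_map])

theorem norm_sub_le_modulus (f : E) {s τ : ℝ} (h : |τ| ≤ s) : ‖f - T τ f‖ ≤ T.modulus f s :=
  le_csSup (T.bddAbove_modulus f s) ⟨τ, h, rfl⟩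

theorem modulus_nonneg (f : E) (s : ℝ) : 0 ≤ T.modulus f s := by
  refine Real.sSup_nonneg ?_
  rintro _ ⟨τ, -, rfl⟩
  exact norm_nonneg _

theorem tendsto_modulus (f : E) : Tendsto (T.modulus f) (𝓝[>] 0) (𝓝 0) := by
  rw [Metric.tendsto_nhds]
  intro ε hε
  have hc : Continuous fun τ : ℝ => ‖f - T τ f‖ :=
    (continuous_const.sub (T.continuous_orbit f)).norm
  have h0 : ‖f - T 0 f‖ < ε / 2 := by
    rw [map_zero_apply, sub_self, norm_zero]
    exact half_pos hε
  obtain ⟨δ, hδ, h⟩ := Metric.eventually_nhds_iff.1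
    (hc.continuousAt.eventually_lt continuousAt_const h0)
  filter_upwards [Ioo_mem_nhdsGT hδ] with s hs
  rw [Real.dist_eq, sub_zero, abs_of_nonneg (T.modulus_nonneg f s)]
  refine lt_of_le_of_lt (csSup_le ⟨_, 0, by simpa using hs.1.le, rfl⟩ ?_) (half_lt_self hε)
  rintro _ ⟨τ, hτ, rfl⟩
  refine (h ?_).le
  rw [Real.dist_eq, sub_zero]
  exact lt_of_le_of_lt hτ hs.2

/-- Telescoping: since `T` is isometric, each step of length `τ` costs the same. -/
theorem norm_sub_nat_mul_le (f : E) (τ : ℝ) (n : ℕ) :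
    ‖f - T (n * τ) f‖ ≤ n * ‖f - T τ f‖ := by
  induction n with
  | zero => simp [map_zero_apply]
  | succ n ih =>
    have h : f - T ((n + 1 : ℕ) * τ) f = (f - T τ f) + T τ (f - T (n * τ) f) := by
      rw [map_sub, ← map_add_apply]
      push_cast
      rw [add_mul, one_mul, add_comm τ]
      abel
    rw [h]
    refine (norm_add_le _ _).trans ?_
    rw [(T τ).norm_map]
    push_cast
    linarith

theorem norm_sub_le_one_add_abs_mul_modulus (f : E) {σ : ℝ} (hσ : 0 < σ) (t : ℝ) :
    ‖f - T (t / σ) f‖ ≤ (1 + |t|) * T.modulus f (1 / σ) := by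
  -- The `+ 1` gives `|t| ≤ n ≤ 1 + |t|` and keeps `n` nonzero even at `t = 0`.
  set n : ℕ := ⌊|t|⌋₊ + 1 with hn
  have hn0 : (0 : ℝ) < n := by positivity
  have h₁ : |t| ≤ n := by
    rw [hn]
    push_cast
    exact (Nat.lt_floor_add_one _).le
  have h₂ : (n : ℝ) ≤ 1 + |t| := by
    rw [hn]
    push_cast
    linarith [Nat.floor_le (abs_nonneg t)]
  have h₃ : |t / σ / n| ≤ 1 / σ := by
    rw [abs_div, abs_div, abs_of_pos hσ, abs_of_pos hn0, div_div, div_le_div_iff₀ (by positivity) hσ]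
    nlinarith
  have h₄ := T.norm_sub_nat_mul_le f (t / σ / n) n
  rw [mul_div_cancel₀ _ hn0.ne'] at h₄
  exact h₄.trans (mul_le_mul h₂ (T.norm_sub_le_modulus f h₃) (norm_nonneg _) (by positivity))

theorem integrable_smul_orbit [NormedSpace ℝ E] {w : ℝ → ℝ} (hw : Integrable w) (σ : ℝ) (f : E) :
    Integrable fun t : ℝ => w t • T (t / σ) f := by
  have hc : Continuous fun t : ℝ => T (t / σ) f :=
    (T.continuous_orbit f).comp (continuous_id.div_const σ)
  refine (hw.norm.mul_const ‖f‖).mono' (hw.1.smul hc.aestronglyMeasurable)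
    (.of_forall fun t => ?_)
  rw [norm_smul, (T _).norm_map]

/-- The shift sits in the kernel because the orbit of a general `f` need not be differentiable. -/
theorem hasDerivAt_integral_normKernel_sub_smul [NormedSpace ℝ E] (σ : ℝ) (f : E) :
    HasDerivAt (fun a : ℝ => ∫ t : ℝ, normKernel (t - a) • T (t / σ) f)
      (-∫ t : ℝ, deriv normKernel t • T (t / σ) f) 0 := by
  obtain ⟨C, hC⟩ := exists_abs_deriv_normKernel_le
  have hc : Continuous fun t : ℝ => T (t / σ) f :=
    (T.continuous_orbit f).comp (continuous_id.div_const σ)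
  have key := hasDerivAt_integral_of_dominated_loc_of_deriv_le (μ := volume) (x₀ := (0 : ℝ))
    (F := fun (a t : ℝ) => normKernel (t - a) • T (t / σ) f)
    (F' := fun (a t : ℝ) => (-deriv normKernel (t - a)) • T (t / σ) f)
    (bound := fun t => C * (1 + t ^ 2)⁻¹ * ‖f‖) (s := Set.Icc (-1) 1)
    (Icc_mem_nhds (by norm_num) (by norm_num))
    (.of_forall fun a => ((continuous_normKernel.comp (continuous_sub_right a)).smul
      hc).aestronglyMeasurable)
    (by simpa using T.integrable_smul_orbit integrable_normKernel σ f)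
    (((measurable_deriv normKernel).comp (measurable_id.sub_const 0)).neg.aestronglyMeasurable.smul
      hc.aestronglyMeasurable)
    (.of_forall fun t a ha => by
      rw [norm_smul, (T _).norm_map, norm_neg, Real.norm_eq_abs]
      exact mul_le_mul_of_nonneg_right (hC t a (abs_le.2 ha)) (norm_nonneg f))
    ((integrable_inv_one_add_sq.const_mul C).mul_const ‖f‖)
    (.of_forall fun t a _ => by
      have h := (hasDerivAt_normKernel (t - a)).comp_const_sub t a
      exact h.smul_const _)
  simp only [sub_zero, neg_smul, integral_neg] at key
  exact key.2

end Basic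

/-! ### The Riesz operator, the Bernstein estimate and approximation by averages. -/

section Average

variable {𝕜 E : Type*} [RCLike 𝕜] [NormedAddCommGroup E] [NormedSpace 𝕜 E]
  [NormedSpace ℝ E] [IsScalarTower ℝ 𝕜 E] (T : IsometryGroup 𝕜 E)

theorem hasGenerator_iff_hasDerivAt {f g : E} :
    T.HasGenerator f g ↔ HasDerivAt (fun t : ℝ => T t f) g 0 := by
  rw [hasDerivAt_iff_tendsto_slope_zero, HasGenerator]
  simp only [zero_add, map_zero_apply]
  refine tendsto_congr fun t => ?_
  rw [RCLike.real_smul_eq_coe_smul (K := 𝕜) t⁻¹, RCLike.ofReal_inv]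

/-- The group operator `T t` as a continuous real-linear map. -/
def realMap (t : ℝ) : E →L[ℝ] E := (T t).toContinuousLinearMap.restrictScalars ℝ

@[simp]
theorem realMap_apply (t : ℝ) (f : E) : T.realMap t f = T t f := rfl

theorem norm_realMap_le (t : ℝ) : ‖T.realMap t‖ ≤ 1 :=
  ContinuousLinearMap.opNorm_le_bound _ zero_le_one fun f => by simp

theorem norm_realMap_sub_le (s t : ℝ) : ‖T.realMap s - T.realMap t‖ ≤ 2 :=
  (norm_sub_le _ _).trans (by linarith [T.norm_realMap_le s, T.norm_realMap_le t])

/-- The bounded operator by which the Riesz interpolation formula expresses the generator on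
band-limited vectors. -/
noncomputable def rieszOperator (σ : ℝ) : E →L[ℝ] E :=
  ∑' k, (σ * rieszCoeff k) • (T.realMap (rieszNode k / σ) - T.realMap (-rieszNode k / σ))

theorem norm_rieszTerm_le (σ : ℝ) (k : ℕ) :
    ‖(σ * rieszCoeff k) • (T.realMap (rieszNode k / σ) - T.realMap (-rieszNode k / σ))‖
      ≤ |σ| * 2 * |rieszCoeff k| := by
  rw [norm_smul, norm_mul, Real.norm_eq_abs, Real.norm_eq_abs]
  have := mul_le_mul_of_nonneg_left
    (T.norm_realMap_sub_le (rieszNode k / σ) (-rieszNode k / σ))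
    (mul_nonneg (abs_nonneg σ) (abs_nonneg (rieszCoeff k)))
  linarith

theorem norm_rieszOperator_le (σ : ℝ) : ‖T.rieszOperator σ‖ ≤ |σ| := by
  have h := tsum_of_norm_bounded (hasSum_abs_rieszCoeff.mul_left (|σ| * 2))
    (T.norm_rieszTerm_le σ)
  rwa [show |σ| * 2 * (1 / 2) = |σ| by ring] at h

variable [CompleteSpace E]

theorem hasSum_rieszOperator (σ : ℝ) (f : E) :
    HasSum (fun k => (σ * rieszCoeff k) • (T (rieszNode k / σ) f - T (-rieszNode k / σ) f))
      (T.rieszOperator σ f) :=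
  (Summable.of_norm_bounded (hasSum_abs_rieszCoeff.summable.mul_left (|σ| * 2))
    (T.norm_rieszTerm_le σ)).hasSum.mapL (ContinuousLinearMap.apply ℝ E f)

theorem map_rieszOperator (σ s : ℝ) (f : E) :
    T s (T.rieszOperator σ f) = T.rieszOperator σ (T s f) := by
  refine ((T.hasSum_rieszOperator σ f).mapL (T.realMap s)).unique
    ((T.hasSum_rieszOperator σ (T s f)).congr_fun fun k => ?_)
  rw [map_smul, map_sub, realMap_apply, realMap_apply, T.map_comm s, T.map_comm s]

variable {T} in
theorem HasGenerator.rieszOperator {f g : E} (h : T.HasGenerator f g) (σ : ℝ) :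
    T.HasGenerator (T.rieszOperator σ f) (T.rieszOperator σ g) := by
  rw [hasGenerator_iff_hasDerivAt] at h ⊢
  refine ((T.rieszOperator σ).hasFDerivAt.comp_hasDerivAt 0 h).congr_of_eventuallyEq
    (.of_forall fun s => ?_)
  exact T.map_rieszOperator σ s f

/-- Once `D g = R g`, commutation propagates it to `D (R ^ k g) = R ^ (k + 1) g`, and `‖R‖ ≤ σ`
bounds every iterate. -/
theorem mem_bernsteinSpace_of_hasGenerator_rieszOperator {σ : ℝ} (hσ : 0 ≤ σ) {g : E}
    (h : T.HasGenerator g (T.rieszOperator σ g)) : g ∈ bernsteinSpace T.generator σ := by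
  have hgen : ∀ k, T.HasGenerator ((T.rieszOperator σ)^[k] g) ((T.rieszOperator σ)^[k + 1] g) := by
    intro k
    induction k with
    | zero => exact h
    | succ k ih =>
      have := ih.rieszOperator σ
      rwa [← Function.iterate_succ_apply' (T.rieszOperator σ),
        ← Function.iterate_succ_apply' (T.rieszOperator σ)] at this
  have hnorm : ∀ k, ‖(T.rieszOperator σ)^[k] g‖ ≤ σ ^ k * ‖g‖ := by
    intro k
    induction k with
    | zero => simp
    | succ k ih =>
      rw [Function.iterate_succ_apply']
      have h₁ := (T.rieszOperator σ).le_of_opNorm_le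
        ((T.norm_rieszOperator_le σ).trans_eq (abs_of_nonneg hσ)) ((T.rieszOperator σ)^[k] g)
      have h₂ := mul_le_mul_of_nonneg_left ih hσ
      rw [pow_succ']
      linarith
  intro k
  obtain ⟨hf, he⟩ := T.exists_power_generator_eq (u := fun k => (T.rieszOperator σ)^[k] g) hgen k
  refine ⟨hf, ?_⟩
  exact he ▸ hnorm k

theorem integral_normKernel_sub_smul (σ : ℝ) (f : E) (a : ℝ) :
    ∫ t : ℝ, normKernel (t - a) • T (t / σ) f = T (a / σ) (T.average σ f) := by
  have h := integral_sub_right_eq_self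
    (fun t : ℝ => normKernel t • T ((t + a) / σ) f) (μ := volume) a
  simp only [sub_add_cancel] at h
  rw [h, average]
  refine Eq.trans ?_ ((T.realMap (a / σ)).integral_comp_comm
    (T.integrable_smul_orbit integrable_normKernel σ f))
  refine integral_congr_ae (.of_forall fun t => ?_)
  simp only [map_smul, realMap_apply]
  rw [← map_add_apply, ← add_div, add_comm]

/-- Riesz's formula for `h'` is integrated termwise against the orbit. Shifting `h` by `+x_k`
applies `T (-x_k / σ)` to the average, so the minus sign in front restores the order of the
differences. -/
theorem integral_deriv_normKernel_smul (σ : ℝ) (f : E) :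
    -(σ • ∫ t : ℝ, deriv normKernel t • T (t / σ) f) = T.rieszOperator σ (T.average σ f) := by
  have hi : ∀ a : ℝ, Integrable fun t => normKernel (t - a) • T (t / σ) f := fun a =>
    T.integrable_smul_orbit (integrable_normKernel.comp_sub_right a) σ f
  have hi' : ∀ a : ℝ, Integrable fun t => normKernel (t + a) • T (t / σ) f := fun a =>
    T.integrable_smul_orbit (integrable_normKernel.comp_add_right a) σ f
  have hadd : ∀ a : ℝ, ∫ t : ℝ, normKernel (t + a) • T (t / σ) f
      = T (-a / σ) (T.average σ f) := fun a => by
    rw [← T.integral_normKernel_sub_smul σ f (-a)]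
    simp only [sub_neg_eq_add]
  set F : ℕ → ℝ → E := fun k t => (rieszCoeff k *
    (normKernel (t + rieszNode k) - normKernel (t - rieszNode k))) • T (t / σ) f with hF
  have hFeq : ∀ k t, F k t = rieszCoeff k • (normKernel (t + rieszNode k) • T (t / σ) f
      - normKernel (t - rieszNode k) • T (t / σ) f) := fun k t => by
    rw [← sub_smul, smul_smul]
  have hFi : ∀ k, Integrable (F k) := fun k => by
    simp only [funext (hFeq k)]
    exact ((hi' _).sub (hi _)).smul (rieszCoeff k)
  have hFn : ∀ k, ∫ t, ‖F k t‖ ≤ |rieszCoeff k| * (2 * ‖f‖) := fun k => by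
    have h₁ := integrable_normKernel.comp_add_right (rieszNode k)
    have h₂ := integrable_normKernel.comp_sub_right (rieszNode k)
    refine (integral_mono (hFi k).norm (((h₁.add h₂).const_mul |rieszCoeff k|).mul_const ‖f‖)
      fun t => ?_).trans (le_of_eq ?_)
    · simp only [hF, norm_smul, norm_mul, (T _).norm_map, Real.norm_eq_abs, Pi.add_apply]
      gcongr
      refine (abs_sub _ _).trans (le_of_eq ?_)
      rw [abs_of_nonneg (normKernel_nonneg _), abs_of_nonneg (normKernel_nonneg _)]
    · simp only [Pi.add_apply]
      rw [integral_mul_const, integral_const_mul, integral_add h₁ h₂,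
        integral_add_right_eq_self, integral_sub_right_eq_self, integral_normKernel]
      ring
  have key := hasSum_integral_of_summable_integral_norm hFi
    (.of_nonneg_of_le (fun k => integral_nonneg fun _ => norm_nonneg _) hFn
      (hasSum_abs_rieszCoeff.summable.mul_right _))
  have hlim : ∀ t, ∑' k, F k t = deriv normKernel t • T (t / σ) f := fun t =>
    ((hasSum_deriv_normKernel t).smul_const _).tsum_eq
  simp only [hlim] at key
  refine ((key.const_smul σ).neg).unique
    ((T.hasSum_rieszOperator σ (T.average σ f)).congr_fun fun k => ?_)
  simp only [funext (hFeq k)]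
  rw [integral_smul, integral_sub (hi' _) (hi _), hadd, T.integral_normKernel_sub_smul σ,
    ← smul_neg, ← smul_neg, neg_sub, smul_smul]

theorem hasGenerator_average {σ : ℝ} (hσ : σ ≠ 0) (f : E) :
    T.HasGenerator (T.average σ f) (T.rieszOperator σ (T.average σ f)) := by
  rw [hasGenerator_iff_hasDerivAt, ← T.integral_deriv_normKernel_smul σ, ← smul_neg]
  have h₁ := (T.hasDerivAt_integral_normKernel_sub_smul σ f)
  -- The chain rule with inner map `u ↦ σ * u` needs the base point in the form `σ * 0`.
  rw [← mul_zero σ] at h₁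
  have h₂ := h₁.scomp (0 : ℝ) ((hasDerivAt_id (0 : ℝ)).const_mul σ)
  rw [mul_one] at h₂
  refine h₂.congr_of_eventuallyEq (.of_forall fun u => ?_)
  simp only [Function.comp_apply, T.integral_normKernel_sub_smul σ]
  rw [mul_div_cancel_left₀ _ hσ]

theorem average_mem_bernsteinSpace {σ : ℝ} (hσ : 0 < σ) (f : E) :
    T.average σ f ∈ bernsteinSpace T.generator σ :=
  T.mem_bernsteinSpace_of_hasGenerator_rieszOperator hσ.le (T.hasGenerator_average hσ.ne' f)

theorem norm_sub_average_le {σ : ℝ} (hσ : 0 < σ) (f : E) :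
    ‖f - T.average σ f‖ ≤ (∫ t : ℝ, normKernel t * (1 + |t|)) * T.modulus f (1 / σ) := by
  have hf : ∫ t : ℝ, normKernel t • f = f := by
    rw [integral_smul_const, integral_normKernel, one_smul]
  have h : f - T.average σ f = ∫ t : ℝ, normKernel t • (f - T (t / σ) f) := by
    simp only [smul_sub]
    rw [integral_sub (integrable_normKernel.smul_const f)
      (T.integrable_smul_orbit integrable_normKernel σ f), hf, average]
  rw [h, ← integral_mul_const]
  refine norm_integral_le_of_norm_le (integrable_normKernel_mul.mul_const _)
    (.of_forall fun t => ?_)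
  rw [norm_smul, Real.norm_of_nonneg (normKernel_nonneg t), mul_assoc]
  exact mul_le_mul_of_nonneg_left (T.norm_sub_le_one_add_abs_mul_modulus f hσ t)
    (normKernel_nonneg t)

theorem tendsto_average (f : E) : Tendsto (fun s : ℝ => T.average (1 / s) f) (𝓝[>] 0) (𝓝 f) := by
  have h := (T.tendsto_modulus f).const_mul (∫ t : ℝ, normKernel t * (1 + |t|))
  rw [mul_zero] at h
  rw [tendsto_iff_norm_sub_tendsto_zero]
  refine squeeze_zero' (.of_forall fun _ => norm_nonneg _) ?_ h
  filter_upwards [self_mem_nhdsWithin] with s hs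
  have := T.norm_sub_average_le (one_div_pos.2 hs) f
  rwa [one_div_one_div, norm_sub_rev] at this

theorem dense_iUnion_bernsteinSpace :
    Dense (⋃ σ ∈ Set.Ici (0 : ℝ), bernsteinSpace T.generator σ) := by
  intro f
  refine mem_closure_of_tendsto (T.tendsto_average f) ?_
  filter_upwards [self_mem_nhdsWithin] with s hs
  have hs' : (0 : ℝ) < 1 / s := one_div_pos.2 hs
  exact Set.mem_biUnion (Set.mem_Ici.2 hs'.le) (T.average_mem_bernsteinSpace hs' f)

end Average

end IsometryGroup

theorem mainTheorem3 {𝕜 E : Type*} [RCLike 𝕜] [NormedAddCommGroup E] [NormedSpace 𝕜 E]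
    [NormedSpace ℝ E] [IsScalarTower ℝ 𝕜 E] [CompleteSpace E] (T : IsometryGroup 𝕜 E) :
    Dense (⋃ σ ∈ Set.Ici (0 : ℝ), bernsteinSpace T.generator σ) ∧
    Integrable sinKernel ∧ 0 < ∫ t : ℝ, sinKernel t ∧
    Integrable (fun t : ℝ => normKernel t * (1 + |t|)) ∧
    (∀ f : E, Tendsto (T.modulus f) (𝓝[>] 0) (𝓝 0)) ∧
    (∀ f : E, ∀ σ : ℝ, 0 < σ →
      Integrable (fun t : ℝ => normKernel t • T (t / σ) f) ∧
      T.average σ f ∈ bernsteinSpace T.generator σ ∧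
      ‖f - T.average σ f‖ ≤ (∫ t : ℝ, normKernel t * (1 + |t|)) * T.modulus f (1 / σ)) :=
  ⟨T.dense_iUnion_bernsteinSpace, integrable_sinKernel, integral_sinKernel_pos,
    integrable_normKernel_mul, T.tendsto_modulus, fun f σ hσ =>
      ⟨T.integrable_smul_orbit integrable_normKernel σ f, T.average_mem_bernsteinSpace hσ f,
        T.norm_sub_average_le hσ f⟩⟩
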